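/- Let $s_0=\sigma_0+it_0\in\mathbb C$. The Euler double zeta-function is $$\zeta_2(s_0,s)=\sum_{m=1}^\infty\frac1{m^{s_0}}\sum_{n=1}^\infty\frac1{(m+n)^{s}}\qquad(\Re s>1,\ \Re(s_0+s)>2),$$ continued meromorphically in $s$; the continuation exists at least in the half-plane $\Re s>\max(0,2-\sigma_0)$ and is analytic there except possibly at $s=1$. Let $C>1$ and $\sigma_1>\max(0,2-\sigma_0)$. Then for all $s=\sigma+it\in\mathbb C\setminus\{1\}$ with $\sigma\ge\sigma_1$ and all real $x\ge1$ with $|t|\le 2\pi x/C$, the two series over $m$ below converge absolutely and $$\zeta_2(s_0,s)=\sum_{m=1}^\infty\ \sum_{1\le n\le x}\frac1{m^{s_0}(m+n)^{s}}-\frac1{1-s}\sum_{m=1}^\infty\frac1{m^{s_0}(m+x)^{s-1}}+E,$$ where $$E=\begin{cases}O(x^{-\sigma})&(\sigma_0>1),\\ O(x^{-\sigma}\log x)&(\sigma_0=1,\ x\ge2),\\ O(x^{1-\sigma-\sigma_0})&(\sigma_0<1),\end{cases}$$ with implied constants depending only on $s_0$, $C$ and $\sigma_1$ (in particular, not on $t$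 or $x$). -/

import Mathlib

/-- The Euler double series `∑_{m ≥ 1} m^{-s₁} ∑_{n ≥ 1} (m + n)^{-s₂}` (both indices are shifted by
one); it converges absolutely for `Re s₂ > 1`, `Re (s₁ + s₂) > 2`. -/
noncomputable def doubleZetaSeries (s₁ s₂ : ℂ) : ℂ :=
  ∑' m : ℕ, 1 / ((m : ℂ) + 1) ^ s₁ * ∑' n : ℕ, 1 / (((m : ℂ) + 1) + ((n : ℂ) + 1)) ^ s₂

/-- `F` is a meromorphic continuation of `s ↦ doubleZetaSeries s₁ s` to the half-plane `a < Re s`.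
Normal form fixes the values: `F` has no removable singularities (and takes the value `0` at its
poles), so `F` is unique on the half-plane. -/
def IsDoubleZetaContinuation (s₁ : ℂ) (a : ℝ) (F : ℂ → ℂ) : Prop :=
  MeromorphicNFOn F {s : ℂ | a < s.re} ∧
    ∀ s : ℂ, a < s.re → 1 < s.re → 2 < (s₁ + s).re → F s = doubleZetaSeries s₁ s

open Classical in
/-- The Euler double zeta-function `ζ₂(s₁, s₂)`: the value at `s₂` of the meromorphic continuation
of the double series in its second variable to a half-plane containing `s₂`. By
`IsDoubleZetaContinuation.doubleZeta_eq` the choice made here is immaterial. -/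
noncomputable def doubleZeta (s₁ s₂ : ℂ) : ℂ :=
  if h : ∃ F : ℂ → ℂ, ∃ a : ℝ, a < s₂.re ∧ IsDoubleZetaContinuation s₁ a F then h.choose s₂ else 0

theorem IsDoubleZetaContinuation.eq {s₁ s : ℂ} {a b : ℝ} {F G : ℂ → ℂ}
    (hF : IsDoubleZetaContinuation s₁ a F) (hG : IsDoubleZetaContinuation s₁ b G)
    (ha : a < s.re) (hb : b < s.re) : F s = G s := by
  set c : ℝ := max a b with hc
  have hcs : c < s.re := max_lt ha hb
  have hFm : MeromorphicOn F {z : ℂ | c < z.re} := fun z hz =>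
    (hF.1 (lt_of_le_of_lt (le_max_left a b) hz : a < z.re)).meromorphicAt
  have hGm : MeromorphicOn G {z : ℂ | c < z.re} := fun z hz =>
    (hG.1 (lt_of_le_of_lt (le_max_right a b) hz : b < z.re)).meromorphicAt
  have hU : IsPreconnected {z : ℂ | c < z.re} := (convex_halfSpace_re_gt c).isPreconnected
  set d : ℝ := max c (max 1 (2 - s₁.re)) with hd
  have hagree : ∀ z : ℂ, d < z.re → (F - G) z = 0 := by
    intro z hz
    simp only [hd, hc, max_lt_iff] at hz
    obtain ⟨⟨h1, h2⟩, h3, h4⟩ := hz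
    have h5 : 2 < (s₁ + z).re := by rw [Complex.add_re]; linarith
    rw [Pi.sub_apply, hF.2 z h1 h3 h5, hG.2 z h2 h3 h5, sub_self]
  have hy : d < ((d + 1 : ℝ) : ℂ).re := by simp
  have hyU : ((d + 1 : ℝ) : ℂ) ∈ {z : ℂ | c < z.re} := lt_of_le_of_lt (le_max_left _ _) hy
  have hopen : IsOpen {z : ℂ | d < z.re} := isOpen_lt continuous_const Complex.continuous_re
  have htop : meromorphicOrderAt (F - G) ((d + 1 : ℝ) : ℂ) = ⊤ := by
    rw [meromorphicOrderAt_eq_top_iff]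
    exact (Filter.eventually_of_mem (hopen.mem_nhds hy) hagree).filter_mono nhdsWithin_le_nhds
  have htop' : meromorphicOrderAt (F - G) s = ⊤ := by
    by_contra h
    exact (hFm.sub hGm).meromorphicOrderAt_ne_top_of_isPreconnected hU hcs hyU h htop
  rw [meromorphicOrderAt_eq_top_iff] at htop'
  have hne : F =ᶠ[nhdsWithin s {s}ᶜ] G := htop'.mono fun z hz => sub_eq_zero.1 hz
  exact (((hF.1 ha).eventuallyEq_nhdsNE_iff_eventuallyEq_nhds (hG.1 hb)).1 hne).eq_of_nhds

/-- Every meromorphic continuation of the double series computes `doubleZeta`. -/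
theorem IsDoubleZetaContinuation.doubleZeta_eq {s₁ s : ℂ} {a : ℝ} {F : ℂ → ℂ}
    (hF : IsDoubleZetaContinuation s₁ a F) (ha : a < s.re) : doubleZeta s₁ s = F s := by
  have h : ∃ F : ℂ → ℂ, ∃ a : ℝ, a < s.re ∧ IsDoubleZetaContinuation s₁ a F := ⟨F, a, ha, hF⟩
  rw [doubleZeta, dif_pos h]
  obtain ⟨b, hb, hG⟩ := h.choose_spec
  exact hG.eq hF hb ha

/-- `m^{-s₀} ∑_{1 ≤ n ≤ x} (m + n)^{-s}`, with `m` shifted by one. -/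
noncomputable def doubleZetaPartialTerm (s₀ s : ℂ) (x : ℝ) (m : ℕ) : ℂ :=
  1 / ((m : ℂ) + 1) ^ s₀ * ∑ n ∈ Finset.Icc 1 ⌊x⌋₊, 1 / (((m : ℂ) + 1) + (n : ℂ)) ^ s

/-- `m^{-s₀} (m + x)^{-(s - 1)}`, with `m` shifted by one. -/
noncomputable def doubleZetaTailTerm (s₀ s : ℂ) (x : ℝ) (m : ℕ) : ℂ :=
  1 / (((m : ℂ) + 1) ^ s₀ * (((m : ℂ) + 1) + (x : ℂ)) ^ (s - 1))

/-- The difference between `ζ₂(s₀, s)` and the two main terms of its first approximation. -/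
noncomputable def doubleZetaApproxError (s₀ s : ℂ) (x : ℝ) : ℂ :=
  doubleZeta s₀ s -
    (∑' m : ℕ, doubleZetaPartialTerm s₀ s x m - 1 / (1 - s) * ∑' m : ℕ, doubleZetaTailTerm s₀ s x m)

/-!
The inner series is a Hurwitz zeta-function, `ζ₂(s₀, s) = ∑ m^{-s₀} ζ(s, m + 1)`, and the whole proof
rests on `(s - 1) ζ(s, y) = y^{1-s} + emRest s y`, where `emRest s y` is `s - 1` times the sum over
`u = y, y + 1, …` of the gaps `∫_u^{u+1} (u^{-s} - v^{-s}) dv`. This series converges for `Re s > 0`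
because each gap is at most `(|s| / σ) (u^{-σ} - (u+1)^{-σ})`, which telescopes to
`|emRest s y| ≤ |s - 1| (|s| / σ) y^{-σ}`.

Continuation: this bound makes `∑ m^{-s₀} (s - 1) ζ(s, m + 1)` (`hurwitzTerm`) converge locally
uniformly on `Re s > max(0, 2 - σ₀)`, so that its sum is holomorphic there
(`differentiableOn_tsum_hurwitzTerm`). Dividing by `s - 1` gives the meromorphic continuation, and
`doubleZeta` is its normal form.

Approximation: splitting off the terms with `n ≤ x` of `ζ(s, m + 1)` leaves, for each `m`, the main
term `(m + x)^{1-s} / (s - 1)`, an integral over at most one unit, and `emRest s y` with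
`y = m + ⌊x⌋ + 1`, divided by `s - 1`. What is needed is `emRest s y = O(|s - 1| y^{-σ})` without the
factor `|s| / σ` (`exists_norm_emRest_le`). If `|t| ≤ σ` that factor is at most `2`. Otherwise
`σ < |t| ≤ c y` with `c = 2π / C < 2π`, and near any `u ≥ y` the terms are nearly a geometric
progression, `(u + v)^{-s} ≈ u^{-s} e^{irv}` with `r = -t / u`, `|r| ≤ c`. For an exact geometric
progression the gap is the difference of consecutive values of the sequence times
`b(r) = 1 / (e^{ir} - 1) - 1 / (ir)`. As `|r| ≤ c` stays away from the poles `±2π`, `b` is bounded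
and Lipschitz, so `u^{-s} b(-t / u)` is a discrete primitive of the gaps up to an error
`O((σ + 1) u^{-σ-1})` (`norm_discrete_primitive_sub_le`), and summation over `u` gives the bound.
It remains to estimate `∑ m^{-σ₀} (m + x)^{-σ}`, by splitting at `m = x`
(`exists_sum_rpow_neg_mul_rpow_neg_le`).
-/

/-! ### Powers of positive reals -/

theorem norm_ofReal_cpow_neg {u : ℝ} (hu : 0 < u) (s : ℂ) : ‖(u : ℂ) ^ (-s)‖ = u ^ (-s.re) := by
  rw [Complex.norm_cpow_eq_rpow_re_of_pos hu, Complex.neg_re]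

theorem norm_ofReal_cpow_one_sub {u : ℝ} (hu : 0 < u) (s : ℂ) :
    ‖(u : ℂ) ^ (1 - s)‖ = u ^ (1 - s.re) := by
  rw [Complex.norm_cpow_eq_rpow_re_of_pos hu, Complex.sub_re, Complex.one_re]

theorem intervalIntegrable_ofReal_cpow {u v : ℝ} (hu : 0 < u) (huv : u ≤ v) (r : ℂ) :
    IntervalIntegrable (fun w : ℝ => (w : ℂ) ^ r) MeasureTheory.volume u v := by
  refine ContinuousOn.intervalIntegrable fun w hw => ?_
  rw [Set.uIcc_of_le huv] at hw
  exact (Complex.continuousAt_ofReal_cpow_const w r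
    (Or.inr (hu.trans_le hw.1).ne')).continuousWithinAt

/-- The mean value bound, kept in a form that telescopes when summed over adjacent intervals. -/
theorem norm_cpow_neg_sub_le {s : ℂ} (hs : 0 < s.re) {u v : ℝ} (hu : 0 < u) (huv : u ≤ v) :
    ‖(u : ℂ) ^ (-s) - (v : ℂ) ^ (-s)‖ ≤ ‖s‖ / s.re * (u ^ (-s.re) - v ^ (-s.re)) := by
  have h0 : (0 : ℝ) ∉ Set.uIcc u v := by
    rw [Set.uIcc_of_le huv]; exact fun h => absurd h.1 (not_le.2 hu)
  have hs0 : s ≠ 0 := fun h => by simp [h] at hs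
  have h1 : (u : ℂ) ^ (-s) - (v : ℂ) ^ (-s) = s * ∫ w in u..v, (w : ℂ) ^ (-s - 1) := by
    rw [integral_cpow (Or.inr ⟨fun h => hs0 (by linear_combination -h), h0⟩)]
    simp only [sub_add_cancel]
    field_simp
    ring
  have h2 : ∫ w in u..v, w ^ (-s.re - 1) = (u ^ (-s.re) - v ^ (-s.re)) / s.re := by
    rw [integral_rpow (Or.inr ⟨by linarith, h0⟩), sub_add_cancel]
    field_simp
    ring
  have h3 : ‖∫ w in u..v, (w : ℂ) ^ (-s - 1)‖ ≤ ∫ w in u..v, w ^ (-s.re - 1) := by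
    refine intervalIntegral.norm_integral_le_of_norm_le huv ?_
      (intervalIntegral.intervalIntegrable_rpow (Or.inr h0))
    refine Filter.Eventually.of_forall fun w hw => le_of_eq ?_
    rw [Complex.norm_cpow_eq_rpow_re_of_pos (hu.trans hw.1)]
    simp
  rw [h1, norm_mul]
  calc ‖s‖ * ‖∫ w in u..v, (w : ℂ) ^ (-s - 1)‖
      ≤ ‖s‖ * ((u ^ (-s.re) - v ^ (-s.re)) / s.re) := by
        rw [← h2]; gcongr
    _ = _ := by ring

theorem rpow_neg_le_rpow_neg {u v σ : ℝ} (hσ : 0 ≤ σ) (hu : 0 < u) (huv : u ≤ v) :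
    v ^ (-σ) ≤ u ^ (-σ) :=
  Real.rpow_le_rpow_of_nonpos hu huv (by linarith)

theorem mul_rpow_le_rpow_neg_sub {u v σ : ℝ} (hσ : 0 < σ) (hu : 0 < u) (hv : 0 < v) :
    σ * (v - u) * v ^ (-σ - 1) ≤ u ^ (-σ) - v ^ (-σ) := by
  have h1 : (u / v) ^ (-σ) = Real.exp (σ * Real.log (u / v)⁻¹) := by
    rw [Real.rpow_def_of_pos (div_pos hu hv), Real.log_inv]; ring_nf
  have h2 : 1 + σ * (1 - u / v) ≤ (u / v) ^ (-σ) := by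
    rw [h1]
    have h3 := Real.one_sub_inv_le_log_of_pos (inv_pos.2 (div_pos hu hv))
    rw [inv_inv] at h3
    have h4 := Real.add_one_le_exp (σ * Real.log (u / v)⁻¹)
    nlinarith
  rw [Real.div_rpow hu.le hv.le, le_div_iff₀ (Real.rpow_pos_of_pos hv _)] at h2
  rw [Real.rpow_sub_one hv.ne']
  have h5 : (1 + σ * (1 - u / v)) * v ^ (-σ)
      = v ^ (-σ) + σ * (v - u) * (v ^ (-σ) / v) := by
    field_simp
  linarith

theorem rpow_neg_sub_le_mul_rpow {u v σ : ℝ} (hσ : 0 < σ) (hu : 0 < u) (hv : 0 < v) :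
    u ^ (-σ) - v ^ (-σ) ≤ σ * (v - u) * u ^ (-σ - 1) := by
  have := mul_rpow_le_rpow_neg_sub hσ hv hu
  linarith

theorem tendsto_rpow_neg_add_nat {σ : ℝ} (hσ : 0 < σ) (y : ℝ) :
    Filter.Tendsto (fun n : ℕ => (y + n) ^ (-σ)) Filter.atTop (nhds 0) :=
  (tendsto_rpow_neg_atTop hσ).comp
    (Filter.tendsto_atTop_add_const_left _ y tendsto_natCast_atTop_atTop)

/-- The comparison of a sum of powers with the corresponding integral. -/
theorem sum_rpow_neg_le {σ y : ℝ} (hσ : 0 < σ) (hy : 0 < y) (n : ℕ) :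
    ∑ k ∈ Finset.range n, (y + k) ^ (-σ - 1) ≤ y ^ (-σ - 1) + y ^ (-σ) / σ := by
  have h : ∀ n : ℕ, ∑ k ∈ Finset.range (n + 1), (y + k) ^ (-σ - 1)
      ≤ y ^ (-σ - 1) + (y ^ (-σ) - (y + n) ^ (-σ)) / σ := by
    intro n
    induction n with
    | zero => simp
    | succ n ih =>
      rw [Finset.sum_range_succ]
      have hn : 0 < y + n := by positivity
      have hn' : 0 < y + (n + 1 : ℕ) := by positivity
      have h1 := mul_rpow_le_rpow_neg_sub hσ hn hn'
      have h2 : (y + (n + 1 : ℕ)) ^ (-σ - 1)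
          ≤ ((y + n) ^ (-σ) - (y + (n + 1 : ℕ)) ^ (-σ)) / σ := by
        rw [le_div_iff₀ hσ]
        refine le_trans (le_of_eq ?_) h1
        push_cast; ring
      calc _ ≤ y ^ (-σ - 1) + (y ^ (-σ) - (y + n) ^ (-σ)) / σ
            + ((y + n) ^ (-σ) - (y + (n + 1 : ℕ)) ^ (-σ)) / σ := add_le_add ih h2
        _ = _ := by ring
  have hpos : ∀ k : ℕ, 0 < (y + k) ^ (-σ) := fun k => Real.rpow_pos_of_pos (by positivity) _
  rcases n with _ | n
  · simp only [Finset.range_zero, Finset.sum_empty]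
    have := Real.rpow_pos_of_pos hy (-σ - 1)
    have := Real.rpow_pos_of_pos hy (-σ)
    positivity
  · refine (h n).trans ?_
    gcongr
    linarith [hpos n]

theorem summable_rpow_neg {σ y : ℝ} (hσ : 0 < σ) (hy : 0 < y) :
    Summable fun k : ℕ => (y + k) ^ (-σ - 1) :=
  summable_of_sum_range_le (fun _ => Real.rpow_nonneg (by positivity) _) (sum_rpow_neg_le hσ hy)

/-! ### The Euler–Maclaurin remainder of the Hurwitz zeta-function -/

/-- The amount `∫_u^{u+1} (u^{-s} - v^{-s}) dv` by which a term of a Hurwitz zeta series exceeds the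
integral that approximates it. -/
noncomputable def sumIntegralGap (s : ℂ) (u : ℝ) : ℂ :=
  ∫ v in u..(u + 1), ((u : ℂ) ^ (-s) - (v : ℂ) ^ (-s))

/-- `(s - 1) u^{-s} + (u + 1)^{1-s} - u^{1-s}`, which is `s - 1` times `sumIntegralGap s u`; the
factor `s - 1` removes the denominator and leaves an entire function of `s`. -/
noncomputable def emTerm (s : ℂ) (u : ℝ) : ℂ :=
  (s - 1) * (u : ℂ) ^ (-s) + ((u + 1 : ℝ) : ℂ) ^ (1 - s) - (u : ℂ) ^ (1 - s)

/-- `∑_{k ≥ 0} emTerm s (y + k)`: for `Re s > 0` this is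
`(s - 1) ζ(s, y) - y^{1-s}`, where `ζ(s, y)` is the Hurwitz zeta-function. -/
noncomputable def emRest (s : ℂ) (y : ℝ) : ℂ := ∑' k : ℕ, emTerm s (y + k)

theorem emTerm_eq (s : ℂ) {u : ℝ} (hu : 0 < u) : emTerm s u = (s - 1) * sumIntegralGap s u := by
  rcases eq_or_ne s 1 with rfl | hs
  · simp [emTerm]
  have h0 : (0 : ℝ) ∉ Set.uIcc u (u + 1) := by
    rw [Set.uIcc_of_le (by linarith)]; exact fun h => absurd h.1 (not_le.2 hu)
  have hs' : -s + 1 ≠ 0 := fun h => hs (by linear_combination -h)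
  rw [sumIntegralGap, intervalIntegral.integral_sub (by simp)
    (intervalIntegrable_ofReal_cpow hu (by linarith) _),
    integral_cpow (Or.inr ⟨fun h => hs (by linear_combination -h), h0⟩), emTerm,
    show (1 : ℂ) - s = -s + 1 by ring]
  simp only [intervalIntegral.integral_const, add_sub_cancel_left, one_smul]
  field_simp
  ring

theorem norm_sumIntegralGap_le {s : ℂ} (hs : 0 < s.re) {u : ℝ} (hu : 0 < u) :
    ‖sumIntegralGap s u‖ ≤ ‖s‖ / s.re * (u ^ (-s.re) - (u + 1) ^ (-s.re)) := by
  have h := intervalIntegral.norm_integral_le_of_norm_le_const (a := u) (b := u + 1)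
    (C := ‖s‖ / s.re * (u ^ (-s.re) - (u + 1) ^ (-s.re)))
    (f := fun v : ℝ => (u : ℂ) ^ (-s) - (v : ℂ) ^ (-s)) (fun v hv => ?_)
  · simpa [sumIntegralGap] using h
  · rw [Set.uIoc_of_le (by linarith)] at hv
    refine (norm_cpow_neg_sub_le hs hu hv.1.le).trans ?_
    have := rpow_neg_le_rpow_neg hs.le (hu.trans hv.1) hv.2
    gcongr

theorem norm_emTerm_le {s : ℂ} (hs : 0 < s.re) {u : ℝ} (hu : 0 < u) :
    ‖emTerm s u‖ ≤ ‖s - 1‖ * ‖s‖ * u ^ (-s.re - 1) := by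
  have h1 := rpow_neg_sub_le_mul_rpow hs hu (by linarith : 0 < u + 1)
  rw [emTerm_eq s hu, norm_mul, mul_assoc]
  gcongr
  refine (norm_sumIntegralGap_le hs hu).trans ?_
  calc ‖s‖ / s.re * (u ^ (-s.re) - (u + 1) ^ (-s.re))
      ≤ ‖s‖ / s.re * (s.re * (u + 1 - u) * u ^ (-s.re - 1)) := by gcongr
    _ = _ := by field_simp; ring

theorem summable_emTerm {s : ℂ} (hs : 0 < s.re) {y : ℝ} (hy : 0 < y) :
    Summable fun k : ℕ => emTerm s (y + k) :=
  Summable.of_norm_bounded ((summable_rpow_neg hs hy).mul_left (‖s - 1‖ * ‖s‖))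
    fun k => norm_emTerm_le hs (by positivity)

theorem sum_emTerm_eq (s : ℂ) {y : ℝ} (hy : 0 < y) (n : ℕ) :
    ∑ k ∈ Finset.range n, emTerm s (y + k)
      = (s - 1) * ∑ k ∈ Finset.range n, sumIntegralGap s (y + k) := by
  rw [Finset.mul_sum]
  exact Finset.sum_congr rfl fun k _ => emTerm_eq s (by positivity)

theorem norm_emRest_le_of_sum_le {s : ℂ} (hs : 0 < s.re) {y : ℝ} (hy : 0 < y) {B : ℝ}
    (hB : ∀ n : ℕ, ‖∑ k ∈ Finset.range n, sumIntegralGap s (y + k)‖ ≤ B) :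
    ‖emRest s y‖ ≤ ‖s - 1‖ * B := by
  refine le_of_tendsto (summable_emTerm hs hy).hasSum.tendsto_sum_nat.norm
    (Filter.Eventually.of_forall fun n => ?_)
  rw [sum_emTerm_eq s hy, norm_mul]
  exact mul_le_mul_of_nonneg_left (hB n) (norm_nonneg _)

theorem norm_emRest_le {s : ℂ} (hs : 0 < s.re) {y : ℝ} (hy : 0 < y) :
    ‖emRest s y‖ ≤ ‖s - 1‖ * (‖s‖ / s.re * y ^ (-s.re)) := by
  refine norm_emRest_le_of_sum_le hs hy fun n => ?_
  have h : ∑ k ∈ Finset.range n, ‖sumIntegralGap s (y + k)‖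
      ≤ ‖s‖ / s.re * (y ^ (-s.re) - (y + n) ^ (-s.re)) := by
    induction n with
    | zero => simp
    | succ n ih =>
      have h1 := norm_sumIntegralGap_le hs (by positivity : 0 < y + n)
      rw [Finset.sum_range_succ]
      refine (add_le_add ih h1).trans (le_of_eq ?_)
      push_cast
      ring_nf
  refine (norm_sum_le _ _).trans (h.trans ?_)
  have := Real.rpow_pos_of_pos (by positivity : 0 < y + n) (-s.re)
  gcongr
  linarith

theorem emRest_eq_add {s : ℂ} (hs : 0 < s.re) {y : ℝ} (hy : 0 < y) :
    emRest s y = emTerm s y + emRest s (y + 1) := by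
  rw [emRest, (summable_emTerm hs hy).tsum_eq_zero_add, emRest]
  simp only [Nat.cast_zero, add_zero, Nat.cast_add, Nat.cast_one]
  congr 2
  ext k
  congr 1
  ring

/-- `(s - 1) ζ(s, y) = (s - 1) ∑_{n < N} (y + n)^{-s} + (s - 1) ζ(s, y + N)`, for the Hurwitz
zeta-function expressed through `emRest`. -/
theorem cpow_add_emRest {s : ℂ} (hs : 0 < s.re) {y : ℝ} (hy : 0 < y) (N : ℕ) :
    (y : ℂ) ^ (1 - s) + emRest s y
      = (s - 1) * ∑ n ∈ Finset.range N, ((y + n : ℝ) : ℂ) ^ (-s)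
        + (((y + N : ℝ) : ℂ) ^ (1 - s) + emRest s (y + N)) := by
  induction N with
  | zero => simp
  | succ N ih =>
    rw [ih, emRest_eq_add hs (by positivity : 0 < y + N), emTerm, Finset.sum_range_succ,
      show y + ((N + 1 : ℕ) : ℝ) = y + N + 1 by push_cast; ring]
    ring

theorem tsum_cpow_neg {s : ℂ} (hs : 1 < s.re) {y : ℝ} (hy : 0 < y) :
    (s - 1) * ∑' n : ℕ, ((y + n : ℝ) : ℂ) ^ (-s) = (y : ℂ) ^ (1 - s) + emRest s y := by
  have hs0 : 0 < s.re := by linarith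
  have hsum : Summable fun n : ℕ => ((y + n : ℝ) : ℂ) ^ (-s) := by
    refine Summable.of_norm ?_
    have h := summable_rpow_neg (by linarith : 0 < s.re - 1) hy
    refine h.congr fun n => ?_
    rw [norm_ofReal_cpow_neg (by positivity)]
    ring_nf
  have hN : Filter.Tendsto (fun N : ℕ => ((y + N : ℝ) : ℂ) ^ (1 - s)) Filter.atTop (nhds 0) := by
    rw [tendsto_zero_iff_norm_tendsto_zero]
    refine (tendsto_rpow_neg_add_nat (by linarith : 0 < s.re - 1) y).congr fun n => ?_
    rw [norm_ofReal_cpow_one_sub (by positivity), neg_sub]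
  have hR : Filter.Tendsto (fun N : ℕ => emRest s (y + N)) Filter.atTop (nhds 0) := by
    have h := ((tendsto_rpow_neg_add_nat hs0 y).const_mul (‖s‖ / s.re)).const_mul ‖s - 1‖
    rw [mul_zero, mul_zero] at h
    exact squeeze_zero_norm (fun N => norm_emRest_le hs0 (by positivity)) h
  have h := (hsum.hasSum.tendsto_sum_nat.const_mul (s - 1)).add (hN.add hR)
  rw [add_zero, add_zero] at h
  refine tendsto_nhds_unique h ?_
  exact tendsto_const_nhds.congr fun N => cpow_add_emRest hs0 hy N

/-! ### The remainder at heights below `2πy` -/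

open Complex in
/-- The function `b(r) = 1 / (e^{ir} - 1) - 1 / (ir)` is bounded and Lipschitz on every interval
`|r| ≤ c` with `c < 2π`, the pole at `0` being removable. It converts the difference between a
term of a geometric progression of ratio `e^{ir}` and the corresponding integral into a difference of
consecutive values. -/
theorem exists_bounded_lipschitz_sumIntegral_kernel {c : ℝ} (hc : c < 2 * Real.pi) :
    ∃ (b : ℝ → ℂ) (M : ℝ), 0 ≤ M ∧ (∀ r, |r| ≤ c → ‖b r‖ ≤ M) ∧
      (∀ r r', |r| ≤ c → |r'| ≤ c → ‖b r - b r'‖ ≤ M * |r - r'|) ∧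
      ∀ r, |r| ≤ c →
        b r * (exp (r * I) - 1) = 1 - ∫ v in (0 : ℝ)..1, exp (r * I * v) := by
  set g : ℂ → ℂ := dslope exp 0 with hg
  have hgd : Differentiable ℂ g := by
    rw [← differentiableOn_univ, hg, differentiableOn_dslope Filter.univ_mem]
    exact differentiable_exp.differentiableOn
  set h : ℂ → ℂ := dslope g 0 with hh
  have hhd : Differentiable ℂ h := by
    rw [← differentiableOn_univ, hh, differentiableOn_dslope Filter.univ_mem]
    exact hgd.differentiableOn
  have hg0 : g 0 = 1 := by simp [hg]
  have hgw : ∀ w, w * g w = exp w - 1 := fun w => by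
    simpa using sub_smul_dslope exp 0 w
  have hhw : ∀ w, w * h w = g w - 1 := fun w => by
    simpa [hg0] using sub_smul_dslope g 0 w
  have hgi : ∀ w, g w = ∫ v in (0 : ℝ)..1, exp (w * v) := by
    intro w
    rcases eq_or_ne w 0 with rfl | hw
    · simp [hg0]
    · rw [integral_exp_mul_complex hw, eq_div_iff hw, mul_comm, hgw]
      simp
  have hne : ∀ r ∈ Set.Icc (-c) c, g (r * I) ≠ 0 := by
    intro r hr h0
    have h1 := hgw (r * I)
    rw [h0, mul_zero] at h1
    obtain ⟨n, hn⟩ := exp_eq_one_iff.1 (sub_eq_zero.1 h1.symm)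
    have h2 : (r : ℂ) = ((n * (2 * Real.pi) : ℝ) : ℂ) := by
      have : (r : ℂ) * I = ((n * (2 * Real.pi) : ℝ) : ℂ) * I := by rw [hn]; push_cast; ring
      exact mul_right_cancel₀ I_ne_zero this
    have h3 : r = n * (2 * Real.pi) := by exact_mod_cast h2
    have h4 : |(n : ℝ)| * (2 * Real.pi) < 1 * (2 * Real.pi) := by
      rw [← abs_of_pos Real.two_pi_pos, ← abs_mul, ← h3, abs_of_pos Real.two_pi_pos, one_mul]
      exact (abs_le.2 hr).trans_lt hc
    have h5 : |(n : ℝ)| < 1 := lt_of_mul_lt_mul_right h4 Real.two_pi_pos.le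
    have h6 : n = 0 := Int.abs_lt_one_iff.1 (by exact_mod_cast h5)
    rw [h3, h6] at h0
    simp [hg0] at h0
  set b : ℝ → ℂ := fun r => -h (r * I) * (g (r * I))⁻¹ with hb
  have hlin : ContDiff ℝ 1 fun r : ℝ => (r : ℂ) * I := ofRealCLM.contDiff.mul contDiff_const
  -- `b` is a quotient of entire functions whose denominator `(e^{ir} - 1) / (ir)` has no zero here
  have hcd : ContDiffOn ℝ 1 b (Set.Icc (-c) c) := by
    refine ContDiffOn.mul ?_ (ContDiffOn.fun_inv ?_ hne)
    · exact (((hhd.contDiff (n := 1)).restrict_scalars ℝ).comp hlin).neg.contDiffOn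
    · exact (((hgd.contDiff (n := 1)).restrict_scalars ℝ).comp hlin).contDiffOn
  obtain ⟨L, hL⟩ := hcd.exists_lipschitzOnWith one_ne_zero (convex_Icc _ _) isCompact_Icc
  obtain ⟨M, hM⟩ := isCompact_Icc.exists_bound_of_continuousOn hcd.continuousOn
  refine ⟨b, max M L, le_max_of_le_right L.2, fun r hr => ?_, fun r r' hr hr' => ?_, fun r hr => ?_⟩
  · exact (hM r (abs_le.1 hr)).trans (le_max_left _ _)
  · have := hL.dist_le_mul r (abs_le.1 hr) r' (abs_le.1 hr')
    rw [dist_eq_norm, Real.dist_eq] at this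
    exact this.trans (by gcongr; exact le_max_right _ _)
  · have h1 := hne r (abs_le.1 hr)
    rw [← hgi, hb, ← hgw, ← neg_sub, ← hhw]
    field_simp

theorem Complex.norm_exp_sub_one_le_norm {z : ℂ} (hz : z.re ≤ 0) :
    ‖Complex.exp z - 1‖ ≤ ‖z‖ := by
  have h := (convex_halfSpace_re_le (0 : ℝ)).norm_image_sub_le_of_norm_deriv_le (𝕜 := ℂ)
    (f := Complex.exp) (C := 1) (x := 0) (y := z) (fun x _ => Complex.differentiableAt_exp)
    (fun x hx => by
      rw [Complex.deriv_exp, Complex.norm_exp]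
      exact Real.exp_le_one_iff.2 hx) (by simp) hz
  simpa using h

/-- For `0 ≤ v ≤ 1` the power `(u + v)^{-s}` is `u^{-s} e^{-itv/u}` up to an error that is smaller by
a factor `u`: locally it is a geometric progression. -/
theorem norm_cpow_neg_sub_exp_le {s : ℂ} (hs : 0 ≤ s.re) {u v : ℝ} (hu : 0 < u)
    (hv0 : 0 ≤ v) (hv1 : v ≤ 1) :
    ‖((u + v : ℝ) : ℂ) ^ (-s) - (u : ℂ) ^ (-s) * Complex.exp ((-s.im / u : ℝ) * Complex.I * v)‖
      ≤ (s.re + |s.im| / u) * u ^ (-s.re - 1) := by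
  have huv : 0 < u + v := by linarith
  have hq : 0 < 1 + v / u := by positivity
  set l : ℝ := Real.log (1 + v / u) with hl
  have hl1 : l ≤ v / u := by have := Real.log_le_sub_one_of_pos hq; linarith
  have hl0 : 0 ≤ l := Real.log_nonneg (by have : 0 ≤ v / u := by positivity
                                          linarith)
  have hl2 : v / u - l ≤ (v / u) ^ 2 := by
    have h1 := Real.one_sub_inv_le_log_of_pos hq
    have h2 : v / u - (1 - (1 + v / u)⁻¹) = (v / u) ^ 2 / (1 + v / u) := by
      field_simp; ring
    have h3 : (v / u) ^ 2 / (1 + v / u) ≤ (v / u) ^ 2 :=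
      div_le_self (sq_nonneg _) (by have : 0 ≤ v / u := by positivity
                                    linarith)
    linarith
  -- `(1 + v / u)^{-s} = e^{-itv/u} e^δ` with `Re δ ≤ 0`
  set δ : ℂ := ((-s.re * l : ℝ) : ℂ) + ((s.im * (v / u - l) : ℝ) : ℂ) * Complex.I with hδ
  have hδre : δ.re ≤ 0 := by
    simp [hδ]; positivity
  have hvu : v / u ≤ 1 / u := by gcongr
  have hδn : ‖δ‖ ≤ (s.re + |s.im| / u) / u := by
    refine (norm_add_le _ _).trans ?_
    rw [norm_mul, Complex.norm_I, mul_one, Complex.norm_real, Complex.norm_real, Real.norm_eq_abs,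
      Real.norm_eq_abs, abs_mul, abs_mul, abs_neg, abs_of_nonneg hs, abs_of_nonneg hl0,
      abs_of_nonneg (by linarith : 0 ≤ v / u - l)]
    have h1 : s.re * l ≤ s.re * (1 / u) := by gcongr; linarith
    have h2 : |s.im| * (v / u - l) ≤ |s.im| * (1 / u) ^ 2 := by
      gcongr; exact hl2.trans (by gcongr)
    calc _ ≤ s.re * (1 / u) + |s.im| * (1 / u) ^ 2 := add_le_add h1 h2
      _ = _ := by field_simp
  have hsplit : ((u + v : ℝ) : ℂ) ^ (-s)
      = (u : ℂ) ^ (-s) * Complex.exp ((-s.im / u : ℝ) * Complex.I * v) * Complex.exp δ := by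
    have hlog : Real.log (u + v) = Real.log u + l := by
      rw [hl, ← Real.log_mul hu.ne' hq.ne']; congr 1; field_simp
    rw [Complex.cpow_def_of_ne_zero (by exact_mod_cast huv.ne'),
      Complex.cpow_def_of_ne_zero (by exact_mod_cast hu.ne'), ← Complex.ofReal_log huv.le,
      ← Complex.ofReal_log hu.le, hlog, ← Complex.exp_add, ← Complex.exp_add]
    congr 1
    have hu' : (u : ℂ) ≠ 0 := by exact_mod_cast hu.ne'
    conv_lhs => rw [← Complex.re_add_im s]
    conv_rhs => rw [← Complex.re_add_im s]
    simp only [hδ, Complex.add_im, Complex.ofReal_re, Complex.ofReal_im,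
      Complex.mul_im, Complex.I_re, Complex.I_im]
    push_cast
    ring
  rw [hsplit, show ∀ a b : ℂ, a * b - a = a * (b - 1) from fun a b => by ring, norm_mul, norm_mul,
    Complex.norm_cpow_eq_rpow_re_of_pos hu, Complex.neg_re,
    show ((-s.im / u : ℝ) : ℂ) * Complex.I * v = ((-s.im / u * v : ℝ) : ℂ) * Complex.I by
      push_cast; ring, Complex.norm_exp_ofReal_mul_I, mul_one, Real.rpow_sub_one hu.ne']
  calc u ^ (-s.re) * ‖Complex.exp δ - 1‖ ≤ u ^ (-s.re) * ((s.re + |s.im| / u) / u) := by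
        gcongr
        exact (Complex.norm_exp_sub_one_le_norm hδre).trans hδn
    _ = _ := by ring

theorem sumIntegralGap_eq_integral_zero_one (s : ℂ) (u : ℝ) :
    sumIntegralGap s u = ∫ v in (0 : ℝ)..1, ((u : ℂ) ^ (-s) - ((u + v : ℝ) : ℂ) ^ (-s)) := by
  rw [sumIntegralGap]
  have h := intervalIntegral.integral_comp_add_left (a := 0) (b := 1)
    (fun v : ℝ => (u : ℂ) ^ (-s) - (v : ℂ) ^ (-s)) u
  rw [add_zero] at h
  exact h.symm

/-- If `b` is a kernel as in `exists_bounded_lipschitz_sumIntegral_kernel`, then `u^{-s} b(-t/u)` is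
a discrete primitive of `sumIntegralGap s`, up to an error that is smaller by a factor `u`. -/
theorem norm_discrete_primitive_sub_le {b : ℝ → ℂ} {M c : ℝ} (hM : 0 ≤ M)
    (hb : ∀ r, |r| ≤ c → ‖b r‖ ≤ M)
    (hbL : ∀ r r', |r| ≤ c → |r'| ≤ c → ‖b r - b r'‖ ≤ M * |r - r'|)
    (hbE : ∀ r, |r| ≤ c → b r * (Complex.exp (r * Complex.I) - 1)
      = 1 - ∫ v in (0 : ℝ)..1, Complex.exp (r * Complex.I * v))
    {s : ℂ} (hs : 0 ≤ s.re) {u : ℝ} (hu : 0 < u) (ht : |s.im| / u ≤ c) :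
    ‖((u + 1 : ℝ) : ℂ) ^ (-s) * b (-s.im / (u + 1)) - (u : ℂ) ^ (-s) * b (-s.im / u)
        - sumIntegralGap s u‖ ≤ (M + 1) * (s.re + 2 * c) * u ^ (-s.re - 1) := by
  have hc : 0 ≤ c := le_trans (by positivity) ht
  set r : ℝ := -s.im / u with hr
  set r' : ℝ := -s.im / (u + 1) with hr'
  have hrc : |r| ≤ c := by rwa [hr, abs_div, abs_neg, abs_of_pos hu]
  have hrc' : |r'| ≤ c := by
    rw [hr', abs_div, abs_neg, abs_of_pos (by linarith : 0 < u + 1)]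
    refine le_trans ?_ ht
    gcongr
    linarith
  have hrr : |r' - r| ≤ c / u := by
    have h1 : r' - r = s.im / u * (1 / (u + 1)) := by
      rw [hr, hr']; field_simp; ring
    rw [h1, abs_mul, abs_div, abs_of_pos hu, abs_of_pos (by positivity : 0 < 1 / (u + 1)),
      div_eq_mul_one_div c u]
    gcongr
    linarith
  set X : ℝ := u ^ (-s.re - 1) with hX
  have hX0 : 0 ≤ X := Real.rpow_nonneg hu.le _
  set g : ℝ → ℂ := fun v => ((u + v : ℝ) : ℂ) ^ (-s)
    - (u : ℂ) ^ (-s) * Complex.exp (r * Complex.I * v) with hg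
  have hgb : ∀ v ∈ Set.Icc (0 : ℝ) 1, ‖g v‖ ≤ (s.re + c) * X := fun v hv => by
    refine (norm_cpow_neg_sub_exp_le hs hu hv.1 hv.2).trans ?_
    gcongr
  have hcpow : IntervalIntegrable (fun v : ℝ => ((u + v : ℝ) : ℂ) ^ (-s))
      MeasureTheory.volume 0 1 := by
    refine ContinuousOn.intervalIntegrable fun v hv => ?_
    rw [Set.uIcc_of_le zero_le_one] at hv
    have h1 : ContinuousAt (fun w : ℝ => (w : ℂ) ^ (-s)) (u + v) :=
      Complex.continuousAt_ofReal_cpow_const _ _ (Or.inr (by linarith [hv.1]))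
    exact (ContinuousAt.comp (f := fun v : ℝ => u + v) h1 (by fun_prop)).continuousWithinAt
  have hexp : IntervalIntegrable (fun v : ℝ => (u : ℂ) ^ (-s) * Complex.exp (r * Complex.I * v))
      MeasureTheory.volume 0 1 := Continuous.intervalIntegrable (by fun_prop) _ _
  have hgap : sumIntegralGap s u = (u : ℂ) ^ (-s) * (b r * (Complex.exp (r * Complex.I) - 1))
      - ∫ v in (0 : ℝ)..1, g v := by
    rw [hbE r hrc, hg, intervalIntegral.integral_sub hcpow hexp,
      intervalIntegral.integral_const_mul, sumIntegralGap_eq_integral_zero_one,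
      intervalIntegral.integral_sub (by simp) hcpow]
    simp only [intervalIntegral.integral_const, sub_zero, one_smul]
    ring
  have hint : ‖∫ v in (0 : ℝ)..1, g v‖ ≤ (s.re + c) * X := by
    have h := intervalIntegral.norm_integral_le_of_norm_le_const (a := 0) (b := 1) (f := g)
      (C := (s.re + c) * X) fun v hv => hgb v (by
        rw [Set.uIoc_of_le zero_le_one] at hv; exact ⟨hv.1.le, hv.2⟩)
    simpa using h
  have h1 : ‖g 1 * b r'‖ ≤ (s.re + c) * X * M := by
    rw [norm_mul]
    exact mul_le_mul (hgb 1 (by simp)) (hb r' hrc') (norm_nonneg _) (by positivity)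
  have h2 : ‖(u : ℂ) ^ (-s) * Complex.exp (r * Complex.I) * (b r' - b r)‖ ≤ M * c * X := by
    rw [norm_mul, norm_mul, Complex.norm_exp_ofReal_mul_I, mul_one, norm_ofReal_cpow_neg hu, hX,
      Real.rpow_sub_one hu.ne']
    calc u ^ (-s.re) * ‖b r' - b r‖ ≤ u ^ (-s.re) * (M * (c / u)) := by
          gcongr
          exact (hbL r' r hrc' hrc).trans (by gcongr)
      _ = _ := by ring
  have hsplit : ((u + 1 : ℝ) : ℂ) ^ (-s) * b r' - (u : ℂ) ^ (-s) * b r - sumIntegralGap s u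
      = g 1 * b r' + (u : ℂ) ^ (-s) * Complex.exp (r * Complex.I) * (b r' - b r)
        + ∫ v in (0 : ℝ)..1, g v := by
    rw [hgap]
    simp only [hg, Complex.ofReal_one, mul_one]
    ring
  rw [hsplit]
  refine (norm_add₃_le.trans (add_le_add (add_le_add h1 h2) hint)).trans ?_
  have : 0 ≤ c * X := by positivity
  nlinarith

/-- The remainder is `O(y^{-σ})` uniformly in `|t| ≤ 2πy/C`: no frequency `t / u` with `u ≥ y`
reaches `2π`, so the sum over `n` and the integral oscillate alike. -/
theorem exists_norm_emRest_le {C σ₁ : ℝ} (hC : 1 < C) (hσ₁ : 0 < σ₁) :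
    ∃ K : ℝ, 0 ≤ K ∧ ∀ (s : ℂ) (y : ℝ), σ₁ ≤ s.re → 1 ≤ y → |s.im| ≤ 2 * Real.pi * y / C →
      ‖emRest s y‖ ≤ ‖s - 1‖ * (K * y ^ (-s.re)) := by
  set c : ℝ := 2 * Real.pi / C with hc
  have hc0 : 0 < c := div_pos Real.two_pi_pos (by linarith)
  have hcpi : c < 2 * Real.pi := div_lt_self Real.two_pi_pos hC
  obtain ⟨b, M, hM, hb, hbL, hbE⟩ := exists_bounded_lipschitz_sumIntegral_kernel hcpi
  refine ⟨2 + (2 * M + (M + 1) * (3 * c + (1 + 2 * c / σ₁))), by positivity,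
    fun s y hσ hy ht => ?_⟩
  have hs : 0 < s.re := hσ₁.trans_le hσ
  have hy0 : 0 < y := by linarith
  have hY : 0 ≤ y ^ (-s.re) := Real.rpow_nonneg hy0.le _
  rcases le_or_gt |s.im| s.re with hcase | hcase
  · refine (norm_emRest_le hs hy0).trans ?_
    gcongr
    have h1 : ‖s‖ / s.re ≤ 2 := by
      rw [div_le_iff₀ hs]
      have h2 := Complex.norm_le_abs_re_add_abs_im s
      rw [abs_of_pos hs] at h2
      linarith
    exact h1.trans (le_add_of_nonneg_right (by positivity))
  · have htc : |s.im| ≤ c * y := ht.trans (le_of_eq (by rw [hc]; ring))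
    refine norm_emRest_le_of_sum_le hs hy0 fun n => ?_
    set H : ℕ → ℂ := fun k => ((y + k : ℝ) : ℂ) ^ (-s) * b (-s.im / (y + k)) with hH
    have hk : ∀ k : ℕ, |s.im| / (y + k) ≤ c := fun k => by
      rw [div_le_iff₀ (by positivity)]
      exact htc.trans (by gcongr; simp)
    have hHb : ∀ k, ‖H k‖ ≤ y ^ (-s.re) * M := fun k => by
      rw [hH, norm_mul, norm_ofReal_cpow_neg (by positivity)]
      refine mul_le_mul (rpow_neg_le_rpow_neg hs.le hy0 (by simp)) (hb _ ?_) (norm_nonneg _) hY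
      rw [abs_div, abs_neg, abs_of_pos (by positivity : 0 < y + k)]
      exact hk k
    have hstep : ∀ k : ℕ, ‖H (k + 1) - H k - sumIntegralGap s (y + k)‖
        ≤ (M + 1) * (s.re + 2 * c) * (y + k) ^ (-s.re - 1) := fun k => by
      have h := norm_discrete_primitive_sub_le hM hb hbL hbE hs.le
        (by positivity : 0 < y + k) (hk k)
      rw [hH]
      simpa only [Nat.cast_add, Nat.cast_one, ← add_assoc] using h
    have hsum : ∑ k ∈ Finset.range n, sumIntegralGap s (y + k)
        = H n - H 0 - ∑ k ∈ Finset.range n, (H (k + 1) - H k - sumIntegralGap s (y + k)) := by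
      rw [Finset.sum_sub_distrib, Finset.sum_range_sub]
      ring
    have herr : ‖∑ k ∈ Finset.range n, (H (k + 1) - H k - sumIntegralGap s (y + k))‖
        ≤ (M + 1) * (s.re + 2 * c) * (y ^ (-s.re - 1) + y ^ (-s.re) / s.re) := by
      refine (norm_sum_le_of_le _ fun k _ => hstep k).trans ?_
      rw [← Finset.mul_sum]
      exact mul_le_mul_of_nonneg_left (sum_rpow_neg_le hs hy0 n) (by positivity)
    -- here `σ < |t| ≤ c y`, which absorbs the factor `σ` of the error term
    have h1 : (s.re + 2 * c) * y ^ (-s.re - 1) ≤ 3 * c * y ^ (-s.re) := by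
      rw [Real.rpow_sub_one hy0.ne', ← mul_div_assoc, div_le_iff₀ hy0]
      have : s.re + 2 * c ≤ 3 * c * y := by nlinarith
      nlinarith
    have h2 : (s.re + 2 * c) * (y ^ (-s.re) / s.re) ≤ (1 + 2 * c / σ₁) * y ^ (-s.re) := by
      have : (s.re + 2 * c) / s.re ≤ 1 + 2 * c / σ₁ := by
        rw [add_div, div_self hs.ne']
        gcongr
      calc _ = (s.re + 2 * c) / s.re * y ^ (-s.re) := by ring
        _ ≤ _ := by gcongr
    rw [hsum]
    calc ‖H n - H 0 - ∑ k ∈ Finset.range n, (H (k + 1) - H k - sumIntegralGap s (y + k))‖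
        ≤ y ^ (-s.re) * M + y ^ (-s.re) * M
          + (M + 1) * (s.re + 2 * c) * (y ^ (-s.re - 1) + y ^ (-s.re) / s.re) :=
          (norm_sub_le _ _).trans
            (add_le_add ((norm_sub_le _ _).trans (add_le_add (hHb n) (hHb 0))) herr)
      _ ≤ y ^ (-s.re) * M + y ^ (-s.re) * M
          + (M + 1) * (3 * c * y ^ (-s.re) + (1 + 2 * c / σ₁) * y ^ (-s.re)) := by
          rw [mul_assoc (M + 1), mul_add (s.re + 2 * c)]
          gcongr
      _ ≤ _ := by linarith

/-! ### Continuation of the double zeta-function -/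

theorem norm_one_div_natCast_add_one_cpow (s₀ : ℂ) (m : ℕ) :
    ‖1 / ((m : ℂ) + 1) ^ s₀‖ = ((m : ℝ) + 1) ^ (-s₀.re) := by
  have h : (0 : ℝ) < (m : ℝ) + 1 := by positivity
  rw [show ((m : ℂ) + 1) = (((m : ℝ) + 1 : ℝ) : ℂ) by push_cast; rfl, one_div, ← Complex.cpow_neg,
    norm_ofReal_cpow_neg h]

theorem add_rpow_le_mul_rpow {w c : ℝ} (hw : 1 ≤ w) (hc : 0 ≤ c) (a : ℝ) :
    (w + c) ^ a ≤ (1 + c) ^ |a| * w ^ a := by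
  have hw0 : 0 < w := by linarith
  rcases le_total 0 a with ha | ha
  · rw [abs_of_nonneg ha, ← Real.mul_rpow (by linarith) hw0.le]
    exact Real.rpow_le_rpow (by linarith) (by nlinarith) ha
  · refine (Real.rpow_le_rpow_of_nonpos hw0 (by linarith) ha).trans ?_
    exact le_mul_of_one_le_left (Real.rpow_nonneg hw0.le _)
      (Real.one_le_rpow (by linarith) (abs_nonneg _))

theorem summable_natCast_add_one_rpow_neg {q : ℝ} (hq : 1 < q) :
    Summable fun m : ℕ => ((m : ℝ) + 1) ^ (-q) := by
  refine (summable_rpow_neg (sub_pos.2 hq) one_pos).congr fun m => ?_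
  rw [add_comm]; ring_nf

/-- A series of holomorphic functions on `a < Re s` whose terms are `O(m^{-(σ + p)})`, locally
uniformly, is holomorphic when `a + p ≥ 1`. -/
theorem differentiableOn_tsum_of_le_rpow {a p : ℝ} (hap : 1 ≤ a + p) {f : ℕ → ℂ → ℂ} {Q : ℂ → ℝ}
    (hf : ∀ m, DifferentiableOn ℂ (f m) {s : ℂ | a < s.re})
    (hQ : ContinuousOn Q {s : ℂ | a < s.re})
    (hb : ∀ m s, a < s.re → ‖f m s‖ ≤ Q s * ((m : ℝ) + 1) ^ (-(s.re + p))) :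
    DifferentiableOn ℂ (fun s => ∑' m, f m s) {s : ℂ | a < s.re} := by
  have hopen : ∀ a : ℝ, IsOpen {s : ℂ | a < s.re} := fun a =>
    isOpen_lt continuous_const Complex.continuous_re
  intro s hs
  have hs' : a < s.re := hs
  set a' : ℝ := (a + s.re) / 2 with ha'
  have hnear : {z : ℂ | a' < z.re} ∩ {z : ℂ | Q z < |Q s| + 1} ∈ nhds s := by
    refine Filter.inter_mem ((hopen a').mem_nhds (show a' < s.re by linarith)) ?_
    exact (hQ.continuousAt ((hopen a).mem_nhds hs)).eventually_lt_const
      (by linarith [le_abs_self (Q s)])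
  obtain ⟨V, hV, hVo, hsV⟩ := mem_nhds_iff.1 hnear
  have hd : DifferentiableOn ℂ (fun s => ∑' m, f m s) V := by
    refine Complex.differentiableOn_tsum_of_summable_norm
      ((summable_natCast_add_one_rpow_neg (by linarith : 1 < a' + p)).mul_left (|Q s| + 1))
      (fun m => (hf m).mono fun z hz => ?_) hVo fun m z hz => ?_
    · have : a' < z.re := (hV hz).1
      exact show a < z.re by linarith
    · have h1 : a' < z.re := (hV hz).1
      have h2 : Q z < |Q s| + 1 := (hV hz).2
      refine (hb m z (by linarith)).trans ?_
      gcongr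
      linarith
  exact (hd.differentiableAt (hVo.mem_nhds hsV)).differentiableWithinAt

theorem differentiable_const_cpow_one_sub {u : ℝ} (hu : 0 < u) :
    Differentiable ℂ fun s : ℂ => (u : ℂ) ^ (1 - s) := fun s =>
  DifferentiableAt.const_cpow (by fun_prop) (Or.inl (by exact_mod_cast hu.ne'))

theorem differentiable_emTerm {u : ℝ} (hu : 0 < u) : Differentiable ℂ fun s => emTerm s u := by
  have h : Differentiable ℂ fun s : ℂ => (u : ℂ) ^ (-s) := fun s =>
    DifferentiableAt.const_cpow (by fun_prop) (Or.inl (by exact_mod_cast hu.ne'))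
  exact (((differentiable_id.sub_const 1).mul h).add
    (differentiable_const_cpow_one_sub (by linarith))).sub (differentiable_const_cpow_one_sub hu)

theorem differentiableOn_emRest {y : ℝ} (hy : 1 ≤ y) :
    DifferentiableOn ℂ (fun s => emRest s y) {s : ℂ | 0 < s.re} := by
  refine differentiableOn_tsum_of_le_rpow (p := 1) (Q := fun s => ‖s - 1‖ * ‖s‖) (by norm_num)
    (fun k => (differentiable_emTerm (by positivity)).differentiableOn)
    (by fun_prop) fun k s hs => ?_
  refine (norm_emTerm_le hs (by positivity)).trans ?_
  rw [neg_add']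
  gcongr ?_ * ?_
  exact Real.rpow_le_rpow_of_nonpos (by positivity) (by linarith) (by linarith)

/-- `m^{-s₀} (s - 1) ζ(s, m + 1)`, with `m` shifted by one; `ζ(s, m + 1)` is the Hurwitz
zeta-function. -/
noncomputable def hurwitzTerm (s₀ s : ℂ) (m : ℕ) : ℂ :=
  1 / ((m : ℂ) + 1) ^ s₀ * (((m + 2 : ℝ) : ℂ) ^ (1 - s) + emRest s (m + 2))

theorem norm_hurwitzTerm_le (s₀ : ℂ) {s : ℂ} (hs : 0 < s.re) (m : ℕ) :
    ‖hurwitzTerm s₀ s m‖ ≤ ((1 + 1) ^ |1 - s.re| + ‖s - 1‖ * (‖s‖ / s.re))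
      * ((m : ℝ) + 1) ^ (-(s.re + (s₀.re - 1))) := by
  have hm : (1 : ℝ) ≤ (m : ℝ) + 1 := by simp
  have hm0 : (0 : ℝ) < (m : ℝ) + 1 := by positivity
  have h1 : ‖((m + 2 : ℝ) : ℂ) ^ (1 - s)‖
      ≤ (1 + 1) ^ |1 - s.re| * ((m : ℝ) + 1) ^ (1 - s.re) := by
    rw [norm_ofReal_cpow_one_sub (by positivity)]
    refine le_trans (le_of_eq ?_) (add_rpow_le_mul_rpow hm zero_le_one _)
    congr 1; ring
  have h2 : ‖emRest s (m + 2)‖ ≤ ‖s - 1‖ * (‖s‖ / s.re) * ((m : ℝ) + 1) ^ (1 - s.re) := by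
    refine (norm_emRest_le hs (by positivity)).trans ?_
    rw [← mul_assoc]
    gcongr ?_ * ?_
    refine (rpow_neg_le_rpow_neg hs.le hm0 (by linarith)).trans ?_
    exact Real.rpow_le_rpow_of_exponent_le hm (by linarith)
  rw [hurwitzTerm, norm_mul, norm_one_div_natCast_add_one_cpow,
    show -(s.re + (s₀.re - 1)) = -s₀.re + (1 - s.re) by ring, Real.rpow_add hm0]
  calc _ ≤ ((m : ℝ) + 1) ^ (-s₀.re) * ((1 + 1) ^ |1 - s.re| * ((m : ℝ) + 1) ^ (1 - s.re)
        + ‖s - 1‖ * (‖s‖ / s.re) * ((m : ℝ) + 1) ^ (1 - s.re)) := by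
        gcongr
        exact (norm_add_le _ _).trans (add_le_add h1 h2)
    _ = _ := by ring

theorem summable_hurwitzTerm {s₀ s : ℂ} (hs : max 0 (2 - s₀.re) < s.re) :
    Summable (hurwitzTerm s₀ s) := by
  rw [max_lt_iff] at hs
  exact Summable.of_norm_bounded
    ((summable_natCast_add_one_rpow_neg (by linarith)).mul_left _)
    (norm_hurwitzTerm_le s₀ hs.1)

theorem differentiableOn_tsum_hurwitzTerm (s₀ : ℂ) :
    DifferentiableOn ℂ (fun s => ∑' m, hurwitzTerm s₀ s m) {s : ℂ | max 0 (2 - s₀.re) < s.re} := by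
  have h0 : ∀ s ∈ {s : ℂ | max 0 (2 - s₀.re) < s.re}, 0 < s.re := fun s hs =>
    (le_max_left _ _).trans_lt hs
  refine differentiableOn_tsum_of_le_rpow (p := s₀.re - 1)
    (Q := fun s => (1 + 1) ^ |1 - s.re| + ‖s - 1‖ * (‖s‖ / s.re))
    (by linarith [le_max_right 0 (2 - s₀.re)]) (fun m => ?_) ?_ fun m s hs =>
      norm_hurwitzTerm_le s₀ (h0 s hs) m
  · refine DifferentiableOn.const_mul ?_ _
    exact (differentiable_const_cpow_one_sub (by positivity)).differentiableOn.add
      ((differentiableOn_emRest (by linarith [Nat.cast_nonneg (α := ℝ) m])).mono h0)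
  · refine ContinuousOn.add ?_ (ContinuousOn.mul (by fun_prop) ?_)
    · exact Continuous.continuousOn
        ((Real.continuous_const_rpow (by norm_num)).comp (by fun_prop))
    · exact continuousOn_id.norm.div Complex.continuous_re.continuousOn fun s hs => (h0 s hs).ne'

theorem tsum_hurwitzTerm_eq (s₀ : ℂ) {s : ℂ} (hs : 1 < s.re) :
    ∑' m, hurwitzTerm s₀ s m = (s - 1) * doubleZetaSeries s₀ s := by
  rw [doubleZetaSeries, ← tsum_mul_left]
  congr 1
  ext m
  rw [hurwitzTerm, ← tsum_cpow_neg hs (by positivity)]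
  have h : ∀ n : ℕ, (((m : ℝ) + 2 + n : ℝ) : ℂ) ^ (-s)
      = 1 / (((m : ℂ) + 1) + ((n : ℂ) + 1)) ^ s := fun n => by
    rw [Complex.cpow_neg, one_div]
    congr 2
    push_cast
    ring
  simp only [h]
  ring

theorem analyticAt_tsum_hurwitzTerm {s₀ s : ℂ} (hs : max 0 (2 - s₀.re) < s.re) :
    AnalyticAt ℂ (fun s => ∑' m, hurwitzTerm s₀ s m) s :=
  (differentiableOn_tsum_hurwitzTerm s₀).analyticAt
    ((isOpen_lt continuous_const Complex.continuous_re).mem_nhds hs)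

/-- `(∑ m^{-s₀} (s - 1) ζ(s, m + 1)) / (s - 1)`. It represents the double zeta-function away from
`s = 1`, where it takes the junk value of a division by zero. -/
noncomputable def doubleZetaQuotient (s₀ s : ℂ) : ℂ := (∑' m, hurwitzTerm s₀ s m) / (s - 1)

theorem analyticAt_doubleZetaQuotient {s₀ s : ℂ} (hs : max 0 (2 - s₀.re) < s.re) (hs1 : s ≠ 1) :
    AnalyticAt ℂ (doubleZetaQuotient s₀) s :=
  (analyticAt_tsum_hurwitzTerm hs).div (by fun_prop) (sub_ne_zero.2 hs1)

theorem meromorphicOn_doubleZetaQuotient (s₀ : ℂ) :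
    MeromorphicOn (doubleZetaQuotient s₀) {s : ℂ | max 0 (2 - s₀.re) < s.re} := fun s hs =>
  (analyticAt_tsum_hurwitzTerm hs).meromorphicAt.div
    (by fun_prop : AnalyticAt ℂ (fun s : ℂ => s - 1) s).meromorphicAt

theorem toMeromorphicNFOn_doubleZetaQuotient_eventuallyEq {s₀ s : ℂ}
    (hs : max 0 (2 - s₀.re) < s.re) (hs1 : s ≠ 1) :
    toMeromorphicNFOn (doubleZetaQuotient s₀) {s : ℂ | max 0 (2 - s₀.re) < s.re}
      =ᶠ[nhds s] doubleZetaQuotient s₀ := by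
  have h := toMeromorphicNFOn_eq_toMeromorphicNFAt_on_nhds
    (meromorphicOn_doubleZetaQuotient s₀) hs
  rwa [toMeromorphicNFAt_eq_self.2 (analyticAt_doubleZetaQuotient hs hs1).meromorphicNFAt] at h

theorem isDoubleZetaContinuation_toMeromorphicNFOn (s₀ : ℂ) :
    IsDoubleZetaContinuation s₀ (max 0 (2 - s₀.re))
      (toMeromorphicNFOn (doubleZetaQuotient s₀) {s : ℂ | max 0 (2 - s₀.re) < s.re}) := by
  refine ⟨meromorphicNFOn_toMeromorphicNFOn _ _, fun s hs h1 _ => ?_⟩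
  have hs1 : s ≠ 1 := fun h => by simp [h] at h1
  rw [(toMeromorphicNFOn_doubleZetaQuotient_eventuallyEq hs hs1).eq_of_nhds, doubleZetaQuotient,
    tsum_hurwitzTerm_eq s₀ h1, mul_div_cancel_left₀ _ (sub_ne_zero.2 hs1)]

theorem doubleZeta_eventuallyEq_toMeromorphicNFOn {s₀ s : ℂ} (hs : max 0 (2 - s₀.re) < s.re) :
    doubleZeta s₀ =ᶠ[nhds s]
      toMeromorphicNFOn (doubleZetaQuotient s₀) {s : ℂ | max 0 (2 - s₀.re) < s.re} :=
  Filter.eventually_of_mem ((isOpen_lt continuous_const Complex.continuous_re).mem_nhds hs)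
    fun _ hz => (isDoubleZetaContinuation_toMeromorphicNFOn s₀).doubleZeta_eq hz

theorem isDoubleZetaContinuation_doubleZeta (s₀ : ℂ) :
    IsDoubleZetaContinuation s₀ (max 0 (2 - s₀.re)) (doubleZeta s₀) := by
  have h := isDoubleZetaContinuation_toMeromorphicNFOn s₀
  refine ⟨fun s hs => ?_, fun s hs h1 h2 => ?_⟩
  · exact (meromorphicNFAt_congr (doubleZeta_eventuallyEq_toMeromorphicNFOn hs)).2 (h.1 hs)
  · rw [h.doubleZeta_eq hs, h.2 s hs h1 h2]

theorem doubleZeta_eventuallyEq_quotient {s₀ s : ℂ} (hs : max 0 (2 - s₀.re) < s.re)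
    (hs1 : s ≠ 1) : doubleZeta s₀ =ᶠ[nhds s] doubleZetaQuotient s₀ :=
  (doubleZeta_eventuallyEq_toMeromorphicNFOn hs).trans
    (toMeromorphicNFOn_doubleZetaQuotient_eventuallyEq hs hs1)

/-! ### Sums over the outer variable -/

theorem sum_natCast_add_one_rpow_neg_le {q : ℝ} (hq0 : 0 < q) (hq1 : q < 1) (n : ℕ) :
    ∑ m ∈ Finset.range n, ((m : ℝ) + 1) ^ (-q) ≤ (n : ℝ) ^ (1 - q) / (1 - q) := by
  have hp : 0 < 1 - q := by linarith
  induction n with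
  | zero => simp [Real.zero_rpow hp.ne']
  | succ n ih =>
    have hn : (0 : ℝ) < (n : ℝ) + 1 := by positivity
    have h1 : ((n : ℝ) / (n + 1)) ^ (1 - q) ≤ 1 - (1 - q) / (n + 1) := by
      have hle : (1 : ℝ) / (n + 1) ≤ 1 := by
        rw [div_le_one hn]; linarith [Nat.cast_nonneg (α := ℝ) n]
      have h := rpow_one_add_le_one_add_mul_self (s := -(1 / ((n : ℝ) + 1))) (by linarith)
        hp.le (by linarith)
      calc ((n : ℝ) / (n + 1)) ^ (1 - q) = (1 + -(1 / ((n : ℝ) + 1))) ^ (1 - q) := by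
            congr 1; field_simp; ring
        _ ≤ _ := h
        _ = _ := by ring
    rw [Real.div_rpow (by positivity) hn.le, div_le_iff₀ (Real.rpow_pos_of_pos hn _)] at h1
    have h2 : ((n : ℝ) + 1) ^ (-q) = ((n : ℝ) + 1) ^ (1 - q) / (n + 1) := by
      rw [← Real.rpow_sub_one hn.ne']; congr 1; ring
    rw [Finset.sum_range_succ, h2, Nat.cast_add, Nat.cast_one]
    have h3 : (1 - (1 - q) / ((n : ℝ) + 1)) * ((n : ℝ) + 1) ^ (1 - q)
        = ((n : ℝ) + 1) ^ (1 - q) - (1 - q) * (((n : ℝ) + 1) ^ (1 - q) / (n + 1)) := by ring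
    rw [h3] at h1
    rw [le_div_iff₀ hp] at ih ⊢
    linarith

/-- The range `m ≤ x`, where `m + x` has the size of `x`, and the range `m > x`, where it has the
size of `m`, contribute the two terms on the right. -/
theorem sum_rpow_neg_mul_rpow_neg_le {σ₀ σ₁ σ x : ℝ} (hσ₁ : 0 ≤ σ₁) (hσ₀₁ : 1 < σ₀ + σ₁)
    (hσ : σ₁ ≤ σ) (hx : 1 ≤ x) (n : ℕ) :
    ∑ m ∈ Finset.range n, ((m : ℝ) + 1) ^ (-σ₀) * ((m : ℝ) + 1 + x) ^ (-σ)
      ≤ x ^ (-σ) * (∑ m ∈ Finset.range ⌊x⌋₊, ((m : ℝ) + 1) ^ (-σ₀)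
        + (1 + 1 / (σ₀ + σ₁ - 1)) * x ^ (1 - σ₀)) := by
  have hx0 : 0 < x := by linarith
  set N : ℕ := ⌊x⌋₊ with hN
  set τ : ℝ := σ₀ + σ₁ - 1 with hτ
  have hτ0 : 0 < τ := by linarith
  have hfar : ∀ k : ℕ, (((N + k : ℕ) : ℝ) + 1) ^ (-σ₀) * (((N + k : ℕ) : ℝ) + 1 + x) ^ (-σ)
      ≤ x ^ (σ₁ - σ) * ((N : ℝ) + 1 + k) ^ (-τ - 1) := by
    intro k
    have hw : (0 : ℝ) < (N : ℝ) + 1 + k := by positivity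
    rw [show ((N + k : ℕ) : ℝ) + 1 = (N : ℝ) + 1 + k by push_cast; ring]
    rw [show -τ - 1 = -σ₀ + -σ₁ by rw [hτ]; ring, Real.rpow_add hw,
      show -σ = (σ₁ - σ) + -σ₁ by ring, Real.rpow_add (by positivity : 0 < (N : ℝ) + 1 + k + x)]
    have h1 : ((N : ℝ) + 1 + k + x) ^ (σ₁ - σ) ≤ x ^ (σ₁ - σ) :=
      Real.rpow_le_rpow_of_nonpos hx0 (by linarith) (by linarith)
    have h2 : ((N : ℝ) + 1 + k + x) ^ (-σ₁) ≤ ((N : ℝ) + 1 + k) ^ (-σ₁) :=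
      rpow_neg_le_rpow_neg hσ₁ hw (by linarith)
    calc _ ≤ ((N : ℝ) + 1 + k) ^ (-σ₀) * (x ^ (σ₁ - σ) * ((N : ℝ) + 1 + k) ^ (-σ₁)) := by
          gcongr
      _ = _ := by ring
  have hfarsum : ∑ k ∈ Finset.range n, ((N : ℝ) + 1 + k) ^ (-τ - 1)
      ≤ (1 + 1 / τ) * x ^ (-τ) := by
    refine (sum_rpow_neg_le hτ0 (by positivity) n).trans ?_
    have h1 : ((N : ℝ) + 1) ^ (-τ) ≤ x ^ (-τ) :=
      rpow_neg_le_rpow_neg hτ0.le hx0 (Nat.lt_floor_add_one x).le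
    have h2 : ((N : ℝ) + 1) ^ (-τ - 1) ≤ ((N : ℝ) + 1) ^ (-τ) :=
      Real.rpow_le_rpow_of_exponent_le (by simp) (by linarith)
    calc _ ≤ x ^ (-τ) + x ^ (-τ) / τ := add_le_add (h2.trans h1) (by gcongr)
      _ = _ := by ring
  have hnear : ∀ m : ℕ, ((m : ℝ) + 1) ^ (-σ₀) * ((m : ℝ) + 1 + x) ^ (-σ)
      ≤ x ^ (-σ) * ((m : ℝ) + 1) ^ (-σ₀) := fun m => by
    rw [mul_comm]
    gcongr ?_ * _
    exact rpow_neg_le_rpow_neg (hσ₁.trans hσ) hx0 (by linarith [Nat.cast_nonneg (α := ℝ) m])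
  have hexp : x ^ (σ₁ - σ) * x ^ (-τ) = x ^ (-σ) * x ^ (1 - σ₀) := by
    rw [← Real.rpow_add hx0, ← Real.rpow_add hx0]; congr 1; rw [hτ]; ring
  calc ∑ m ∈ Finset.range n, ((m : ℝ) + 1) ^ (-σ₀) * ((m : ℝ) + 1 + x) ^ (-σ)
      ≤ ∑ m ∈ Finset.range (N + n), ((m : ℝ) + 1) ^ (-σ₀) * ((m : ℝ) + 1 + x) ^ (-σ) :=
        Finset.sum_le_sum_of_subset_of_nonneg (Finset.range_mono (Nat.le_add_left n N))
          fun m _ _ => by positivity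
    _ ≤ x ^ (-σ) * ∑ m ∈ Finset.range N, ((m : ℝ) + 1) ^ (-σ₀)
        + x ^ (σ₁ - σ) * ((1 + 1 / τ) * x ^ (-τ)) := by
        rw [Finset.sum_range_add]
        refine add_le_add ?_ ?_
        · rw [Finset.mul_sum]
          exact Finset.sum_le_sum fun m _ => hnear m
        · refine (Finset.sum_le_sum fun k _ => hfar k).trans ?_
          rw [← Finset.mul_sum]
          gcongr
    _ = _ := by linear_combination (1 + 1 / τ) * hexp

/-- The size of `∑ m^{-σ₀} (m + x)^{-σ}` in the three ranges of `σ₀`, uniformly in `σ ≥ σ₁`. -/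
theorem exists_sum_rpow_neg_mul_rpow_neg_le {σ₀ σ₁ : ℝ} (hσ₁ : 0 ≤ σ₁) (hσ₀₁ : 1 < σ₀ + σ₁) :
    ∃ K : ℝ, ∀ (σ x : ℝ) (n : ℕ), σ₁ ≤ σ → 1 ≤ x →
      (1 < σ₀ → ∑ m ∈ Finset.range n, ((m : ℝ) + 1) ^ (-σ₀) * ((m : ℝ) + 1 + x) ^ (-σ)
        ≤ K * x ^ (-σ)) ∧
      (σ₀ = 1 → 2 ≤ x → ∑ m ∈ Finset.range n, ((m : ℝ) + 1) ^ (-σ₀) * ((m : ℝ) + 1 + x) ^ (-σ)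
        ≤ K * (x ^ (-σ) * Real.log x)) ∧
      (σ₀ < 1 → ∑ m ∈ Finset.range n, ((m : ℝ) + 1) ^ (-σ₀) * ((m : ℝ) + 1 + x) ^ (-σ)
        ≤ K * x ^ (1 - σ - σ₀)) := by
  set A : ℝ := 1 + 1 / (σ₀ + σ₁ - 1) with hA
  have hA0 : 0 < A := by have : 0 < σ₀ + σ₁ - 1 := by linarith
                         positivity
  have hmain := fun (σ x : ℝ) (n : ℕ) (hσ : σ₁ ≤ σ) (hx : 1 ≤ x) =>
    sum_rpow_neg_mul_rpow_neg_le hσ₁ hσ₀₁ hσ hx n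
  rcases lt_trichotomy σ₀ 1 with h | h | h
  · obtain ⟨B, hB⟩ : ∃ B : ℝ, ∀ x : ℝ, 1 ≤ x →
        ∑ m ∈ Finset.range ⌊x⌋₊, ((m : ℝ) + 1) ^ (-σ₀) ≤ B * x ^ (1 - σ₀) := by
      rcases le_or_gt σ₀ 0 with h0 | h0
      · refine ⟨1, fun x hx => ?_⟩
        have hx0 : 0 < x := by linarith
        have hle : ∀ m ∈ Finset.range ⌊x⌋₊, ((m : ℝ) + 1) ^ (-σ₀) ≤ x ^ (-σ₀) := fun m hm => by
          refine Real.rpow_le_rpow (by positivity) ?_ (by linarith)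
          have h1 : m + 1 ≤ ⌊x⌋₊ := Finset.mem_range.1 hm
          exact_mod_cast (Nat.le_floor_iff hx0.le).1 h1
        refine (Finset.sum_le_card_nsmul _ _ _ hle).trans ?_
        rw [Finset.card_range, nsmul_eq_mul, one_mul, sub_eq_add_neg, Real.rpow_add hx0,
          Real.rpow_one]
        gcongr
        exact Nat.floor_le hx0.le
      · refine ⟨1 / (1 - σ₀), fun x hx => ?_⟩
        refine (sum_natCast_add_one_rpow_neg_le h0 h _).trans ?_
        rw [one_div_mul_eq_div]
        have : 0 < 1 - σ₀ := by linarith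
        gcongr
        exact Nat.floor_le (by linarith)
    refine ⟨B + A, fun σ x n hσ hx => ⟨fun h' => by linarith, fun h' => by linarith, fun _ => ?_⟩⟩
    have hx0 : 0 < x := by linarith
    refine (hmain σ x n hσ hx).trans ?_
    rw [show 1 - σ - σ₀ = -σ + (1 - σ₀) by ring, Real.rpow_add hx0]
    calc _ ≤ x ^ (-σ) * (B * x ^ (1 - σ₀) + A * x ^ (1 - σ₀)) := by
          gcongr
          exact hB x hx
      _ = _ := by ring
  · refine ⟨1 + (1 + A) / Real.log 2, fun σ x n hσ hx =>
      ⟨fun h' => by linarith, fun _ hx2 => ?_, fun h' => by linarith⟩⟩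
    have hx0 : 0 < x := by linarith
    refine (hmain σ x n hσ hx).trans ?_
    have hlog2 : 0 < Real.log 2 := Real.log_pos (by norm_num)
    have hlog : Real.log 2 ≤ Real.log x := Real.log_le_log (by norm_num) hx2
    have hN : (0 : ℝ) < ⌊x⌋₊ := by exact_mod_cast Nat.floor_pos.2 hx
    have hharm : ∑ m ∈ Finset.range ⌊x⌋₊, ((m : ℝ) + 1) ^ (-σ₀) ≤ 1 + Real.log x := by
      have h1 := harmonic_le_one_add_log ⌊x⌋₊
      have h2 : Real.log ⌊x⌋₊ ≤ Real.log x := Real.log_le_log hN (Nat.floor_le hx0.le)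
      refine le_trans (le_of_eq ?_) (h1.trans (by linarith))
      rw [harmonic, h]
      push_cast
      exact Finset.sum_congr rfl fun m _ => Real.rpow_neg_one _
    have h1 : 1 + A ≤ (1 + A) / Real.log 2 * Real.log x := by
      rw [div_mul_eq_mul_div, le_div_iff₀ hlog2]
      gcongr
    have h2 : x ^ (1 - σ₀) = 1 := by rw [h, sub_self, Real.rpow_zero]
    rw [h2, mul_one, mul_left_comm]
    gcongr
    linarith
  · refine ⟨1 + 1 / (σ₀ - 1) + A, fun σ x n hσ hx =>
      ⟨fun _ => ?_, fun h' => by linarith, fun h' => by linarith⟩⟩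
    have hx0 : 0 < x := by linarith
    refine (hmain σ x n hσ hx).trans ?_
    have h1 : ∑ m ∈ Finset.range ⌊x⌋₊, ((m : ℝ) + 1) ^ (-σ₀) ≤ 1 + 1 / (σ₀ - 1) := by
      have h2 := sum_rpow_neg_le (by linarith : 0 < σ₀ - 1) one_pos ⌊x⌋₊
      rw [Real.one_rpow, Real.one_rpow] at h2
      refine le_trans (le_of_eq (Finset.sum_congr rfl fun m _ => ?_)) h2
      rw [add_comm]; ring_nf
    have h2 : x ^ (1 - σ₀) ≤ 1 := Real.rpow_le_one_of_one_le_of_nonpos hx (by linarith)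
    rw [mul_comm]
    gcongr
    exact mul_le_of_le_one_right hA0.le h2

/-! ### The approximation -/

theorem doubleZetaPartialTerm_eq (s₀ s : ℂ) (x : ℝ) (m : ℕ) :
    doubleZetaPartialTerm s₀ s x m = 1 / ((m : ℂ) + 1) ^ s₀
      * ∑ n ∈ Finset.range ⌊x⌋₊, (((m : ℝ) + 2 + n : ℝ) : ℂ) ^ (-s) := by
  rw [doubleZetaPartialTerm, ← Finset.Ico_succ_right_eq_Icc, Finset.sum_Ico_eq_sum_range]
  congr 1
  simp only [Order.succ_eq_add_one, Nat.add_sub_cancel]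
  refine Finset.sum_congr rfl fun n _ => ?_
  rw [Complex.cpow_neg, one_div]
  congr 2
  push_cast
  ring

theorem doubleZetaTailTerm_eq (s₀ s : ℂ) (x : ℝ) (m : ℕ) :
    doubleZetaTailTerm s₀ s x m
      = 1 / ((m : ℂ) + 1) ^ s₀ * (((m : ℝ) + 1 + x : ℝ) : ℂ) ^ (1 - s) := by
  rw [doubleZetaTailTerm, ← neg_sub s 1, Complex.cpow_neg, one_div_mul_eq_div, one_div, mul_inv,
    div_eq_inv_mul]
  push_cast
  rfl

theorem summable_doubleZetaPartialTerm {s₀ s : ℂ} (hs : max 0 (2 - s₀.re) < s.re) (x : ℝ) :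
    Summable (doubleZetaPartialTerm s₀ s x) := by
  rw [max_lt_iff] at hs
  refine Summable.of_norm_bounded ((summable_natCast_add_one_rpow_neg
    (by linarith : 1 < s₀.re + s.re)).mul_left (⌊x⌋₊ : ℝ)) fun m => ?_
  have hm : (0 : ℝ) < (m : ℝ) + 1 := by positivity
  rw [doubleZetaPartialTerm_eq, norm_mul, norm_one_div_natCast_add_one_cpow, neg_add,
    Real.rpow_add hm, mul_left_comm]
  gcongr
  refine (norm_sum_le_of_le _ fun n _ => ?_).trans
    (by rw [Finset.sum_const, Finset.card_range, nsmul_eq_mul])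
  rw [norm_ofReal_cpow_neg (by positivity)]
  exact rpow_neg_le_rpow_neg hs.1.le hm (by linarith [Nat.cast_nonneg (α := ℝ) n])

theorem summable_doubleZetaTailTerm {s₀ s : ℂ} (hs : max 0 (2 - s₀.re) < s.re) {x : ℝ}
    (hx : 0 ≤ x) : Summable (doubleZetaTailTerm s₀ s x) := by
  rw [max_lt_iff] at hs
  refine Summable.of_norm_bounded ((summable_natCast_add_one_rpow_neg
    (by linarith : 1 < s₀.re + s.re - 1)).mul_left ((1 + x) ^ |1 - s.re|)) fun m => ?_
  have hm : (0 : ℝ) < (m : ℝ) + 1 := by positivity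
  rw [doubleZetaTailTerm_eq, norm_mul, norm_one_div_natCast_add_one_cpow,
    norm_ofReal_cpow_one_sub (by positivity),
    show -(s₀.re + s.re - 1) = -s₀.re + (1 - s.re) by ring, Real.rpow_add hm, mul_left_comm]
  gcongr
  exact add_rpow_le_mul_rpow (by simp) hx _

theorem norm_cpow_one_sub_sub_le {s : ℂ} (hs : 0 ≤ s.re) {u v : ℝ} (hu : 0 < u) (huv : u ≤ v)
    (hvu : v ≤ u + 1) :
    ‖(v : ℂ) ^ (1 - s) - (u : ℂ) ^ (1 - s)‖ ≤ ‖s - 1‖ * u ^ (-s.re) := by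
  rcases eq_or_ne s 1 with rfl | hs1
  · simp
  have h0 : (0 : ℝ) ∉ Set.uIcc u v := by
    rw [Set.uIcc_of_le huv]; exact fun h => absurd h.1 (not_le.2 hu)
  have hs' : -s + 1 ≠ 0 := fun h => hs1 (by linear_combination -h)
  have h1 : (v : ℂ) ^ (1 - s) - (u : ℂ) ^ (1 - s) = (1 - s) * ∫ w in u..v, (w : ℂ) ^ (-s) := by
    rw [integral_cpow (Or.inr ⟨fun h => hs1 (by linear_combination -h), h0⟩),
      show (1 : ℂ) - s = -s + 1 by ring]
    field_simp
  rw [h1, norm_mul, norm_sub_rev]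
  gcongr
  have h := intervalIntegral.norm_integral_le_of_norm_le_const (a := u) (b := v)
    (C := u ^ (-s.re)) (f := fun w : ℝ => (w : ℂ) ^ (-s)) fun w hw => by
      rw [Set.uIoc_of_le huv] at hw
      rw [norm_ofReal_cpow_neg (hu.trans hw.1)]
      exact rpow_neg_le_rpow_neg hs hu hw.1.le
  refine h.trans (mul_le_of_le_one_right (Real.rpow_nonneg hu.le _) ?_)
  rw [abs_of_nonneg (by linarith)]
  linarith

/-- The contribution of one `m` to `(s - 1)` times the error of the approximation. -/
noncomputable def approxErrorTerm (s₀ s : ℂ) (x : ℝ) (m : ℕ) : ℂ :=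
  1 / ((m : ℂ) + 1) ^ s₀ * ((((m : ℝ) + 2 + ⌊x⌋₊ : ℝ) : ℂ) ^ (1 - s)
    - (((m : ℝ) + 1 + x : ℝ) : ℂ) ^ (1 - s) + emRest s (m + 2 + ⌊x⌋₊))

theorem hurwitzTerm_eq_add (s₀ : ℂ) {s : ℂ} (hs : 0 < s.re) (x : ℝ) (m : ℕ) :
    hurwitzTerm s₀ s m = (s - 1) * doubleZetaPartialTerm s₀ s x m + doubleZetaTailTerm s₀ s x m
      + approxErrorTerm s₀ s x m := by
  rw [hurwitzTerm, cpow_add_emRest hs (by positivity) ⌊x⌋₊, doubleZetaPartialTerm_eq,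
    doubleZetaTailTerm_eq, approxErrorTerm]
  ring

theorem hasSum_approxErrorTerm {s₀ s : ℂ} (hs : max 0 (2 - s₀.re) < s.re) (hs1 : s ≠ 1) {x : ℝ}
    (hx : 0 ≤ x) :
    HasSum (approxErrorTerm s₀ s x) ((s - 1) * doubleZetaApproxError s₀ s x) := by
  have hs0 : 0 < s.re := (le_max_left _ _).trans_lt hs
  have h := ((summable_hurwitzTerm hs).hasSum.sub
    ((summable_doubleZetaPartialTerm hs x).hasSum.mul_left (s - 1))).sub
    (summable_doubleZetaTailTerm hs hx).hasSum
  have hfun : (fun m => hurwitzTerm s₀ s m - (s - 1) * doubleZetaPartialTerm s₀ s x m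
      - doubleZetaTailTerm s₀ s x m) = approxErrorTerm s₀ s x := by
    ext m
    rw [hurwitzTerm_eq_add s₀ hs0 x m]
    ring
  rw [hfun] at h
  have h1 : s - 1 ≠ 0 := sub_ne_zero.2 hs1
  have heq : (s - 1) * doubleZetaApproxError s₀ s x = ∑' m, hurwitzTerm s₀ s m
      - (s - 1) * ∑' m, doubleZetaPartialTerm s₀ s x m - ∑' m, doubleZetaTailTerm s₀ s x m := by
    rw [doubleZetaApproxError, (doubleZeta_eventuallyEq_quotient hs hs1).eq_of_nhds,
      doubleZetaQuotient, ← neg_sub s 1]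
    field_simp
    ring
  rwa [heq]

theorem exists_norm_approxErrorTerm_le {C σ₁ : ℝ} (s₀ : ℂ) (hC : 1 < C) (hσ₁ : 0 < σ₁) :
    ∃ K : ℝ, 0 ≤ K ∧ ∀ (s : ℂ) (x : ℝ) (m : ℕ), σ₁ ≤ s.re → 1 ≤ x →
      |s.im| ≤ 2 * Real.pi * x / C →
      ‖approxErrorTerm s₀ s x m‖ ≤ ‖s - 1‖
        * (K * (((m : ℝ) + 1) ^ (-s₀.re) * ((m : ℝ) + 1 + x) ^ (-s.re))) := by
  obtain ⟨K, hK0, hK⟩ := exists_norm_emRest_le hC hσ₁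
  refine ⟨1 + K, by positivity, fun s x m hσ hx ht => ?_⟩
  have hs : 0 < s.re := hσ₁.trans_le hσ
  have hm : (0 : ℝ) ≤ m := m.cast_nonneg
  have hfl : (⌊x⌋₊ : ℝ) ≤ x := Nat.floor_le (by linarith)
  have hfl' : x < ⌊x⌋₊ + 1 := Nat.lt_floor_add_one x
  have hxy : (m : ℝ) + 1 + x ≤ m + 2 + ⌊x⌋₊ := by linarith
  have h1 := norm_cpow_one_sub_sub_le hs.le (by linarith : 0 < (m : ℝ) + 1 + x) hxy (by linarith)
  have h2 : ‖emRest s (m + 2 + ⌊x⌋₊)‖ ≤ ‖s - 1‖ * (K * ((m : ℝ) + 1 + x) ^ (-s.re)) := by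
    refine (hK s _ hσ (by linarith) (ht.trans ?_)).trans ?_
    · gcongr
      linarith
    · gcongr ‖s - 1‖ * (K * ?_)
      exact rpow_neg_le_rpow_neg hs.le (by linarith) hxy
  rw [approxErrorTerm, norm_mul, norm_one_div_natCast_add_one_cpow]
  calc _ ≤ ((m : ℝ) + 1) ^ (-s₀.re) * (‖s - 1‖ * ((m : ℝ) + 1 + x) ^ (-s.re)
        + ‖s - 1‖ * (K * ((m : ℝ) + 1 + x) ^ (-s.re))) := by
        gcongr
        exact (norm_add_le _ _).trans (add_le_add h1 h2)
    _ = _ := by ring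

theorem norm_doubleZetaApproxError_le {s₀ s : ℂ} (hs : max 0 (2 - s₀.re) < s.re) (hs1 : s ≠ 1)
    {x : ℝ} (hx : 0 ≤ x) {a : ℕ → ℝ} {K B : ℝ} (hK : 0 ≤ K)
    (ha : ∀ m, ‖approxErrorTerm s₀ s x m‖ ≤ ‖s - 1‖ * (K * a m))
    (hB : ∀ n, ∑ m ∈ Finset.range n, a m ≤ B) : ‖doubleZetaApproxError s₀ s x‖ ≤ K * B := by
  have h : ‖(s - 1) * doubleZetaApproxError s₀ s x‖ ≤ ‖s - 1‖ * (K * B) := by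
    refine le_of_tendsto (hasSum_approxErrorTerm hs hs1 hx).tendsto_sum_nat.norm
      (Filter.Eventually.of_forall fun n => ?_)
    refine (norm_sum_le_of_le _ fun m _ => ha m).trans ?_
    rw [← Finset.mul_sum, ← Finset.mul_sum]
    gcongr
    exact hB n
  rw [norm_mul] at h
  exact le_of_mul_le_mul_left h (norm_pos_iff.2 (sub_ne_zero.2 hs1))

theorem theorem3p1 (s₀ : ℂ) :
    -- the continuation of the double series exists, and is analytic in the region considered
    (IsDoubleZetaContinuation s₀ (max 0 (2 - s₀.re)) (doubleZeta s₀) ∧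
      ∀ s : ℂ, max 0 (2 - s₀.re) < s.re → s ≠ 1 → AnalyticAt ℂ (doubleZeta s₀) s) ∧
    -- the approximation, with a constant depending only on `s₀`, `C` and `σ₁`
    ∀ C σ₁ : ℝ, 1 < C → max 0 (2 - s₀.re) < σ₁ →
      ∃ K : ℝ, ∀ (s : ℂ) (x : ℝ), s ≠ 1 → σ₁ ≤ s.re → 1 ≤ x → |s.im| ≤ 2 * Real.pi * x / C →
        Summable (doubleZetaPartialTerm s₀ s x) ∧
        Summable (doubleZetaTailTerm s₀ s x) ∧
        (1 < s₀.re → ‖doubleZetaApproxError s₀ s x‖ ≤ K * x ^ (-s.re)) ∧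
        (s₀.re = 1 → 2 ≤ x → ‖doubleZetaApproxError s₀ s x‖ ≤ K * (x ^ (-s.re) * Real.log x)) ∧
        (s₀.re < 1 → ‖doubleZetaApproxError s₀ s x‖ ≤ K * x ^ (1 - s.re - s₀.re)) := by
  refine ⟨⟨isDoubleZetaContinuation_doubleZeta s₀, fun s hs hs1 => ?_⟩, fun C σ₁ hC hσ₁ => ?_⟩
  · exact (analyticAt_doubleZetaQuotient hs hs1).congr
      (doubleZeta_eventuallyEq_quotient hs hs1).symm
  · have h0 : 0 < σ₁ ∧ 2 - s₀.re < σ₁ := max_lt_iff.1 hσ₁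
    obtain ⟨K, hK0, hK⟩ := exists_norm_approxErrorTerm_le s₀ hC h0.1
    obtain ⟨L, hL⟩ := exists_sum_rpow_neg_mul_rpow_neg_le h0.1.le
      (by linarith : 1 < s₀.re + σ₁)
    refine ⟨K * L, fun s x hs1 hσ hx ht => ?_⟩
    have hs : max 0 (2 - s₀.re) < s.re := hσ₁.trans_le hσ
    have hx0 : 0 ≤ x := by linarith
    have hbound {B : ℝ} := norm_doubleZetaApproxError_le (B := B) hs hs1 hx0 hK0
      (fun m => hK s x m hσ hx ht)
    simp only [mul_assoc]
    exact ⟨summable_doubleZetaPartialTerm hs x, summable_doubleZetaTailTerm hs hx0,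
      fun h => hbound fun n => (hL s.re x n hσ hx).1 h,
      fun h hx2 => hbound fun n => (hL s.re x n hσ hx).2.1 h hx2,
      fun h => hbound fun n => (hL s.re x n hσ hx).2.2 h⟩
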